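/- Let $T$ be an infinite, locally finite tree without leaves (no vertex has degree $1$), and give $\mathrm{Aut}(T)$ the permutation topology, whose basic open sets are $\{g : g(x)=g_0(x)\ \text{for all } x\in F\}$ for $g_0\in\mathrm{Aut}(T)$ and $F$ a finite set of vertices; subgroups carry the induced topology. Let $G\le \mathrm{Aut}(T)$ be a closed subgroup that does not stabilise any proper non-empty subtree of $T$ and does not fix an end of $T$ (an equivalence class of rays, two rays being equivalent if their intersection is a ray). For $k\in\mathbb{N}$ and an edge $e=\{v,w\}$ of $T$ let $F_{k,e}$ be the group of all $g\in G$ that fix $B(v,k)\cap B(w,k)$ pointwise, where $B(v,k)$ is the set of vertices at distance at most $k$ from $v$. Let $T_{(v,w)}$ denote the half-tree containing $w$ that is obtained by removing the edge $e$ from $T$. Suppose that $G$ satisfies Property $P_k$: for every edge $e=\{v,w\}$, $$F_{k,e}=\mathrm{Fix}_{F_{k,e}}(T_{(v,w)})\,\mathrm{Fix}_{F_{k,e}}(T_{(w,v)}),$$ where $\mathrm{Fix}_{F_{k,e}}(Y)$ is the subgroup of elements of $F_{k,e}$ that fix $Y$ pointwise. Then the group $G^{+_k}:=\langle F_{k,e}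 \mid e \text{ an edge of } T\rangle$ has the closed range property: for every Hausdorff topological group $H$ and every continuous homomorphism $\varphi: G^{+_k}\to H$, the image $\varphi(G^{+_k})$ is closed in $H$. -/

import Mathlib

open scoped Pointwise

universe u v

namespace TreeAut

variable {V : Type u} {T : SimpleGraph V}

/-- The basic set `𝓤(g₀, F)`: the automorphisms that agree with `g₀` on the finite set `F`. -/
def basicSet (g₀ : T ≃g T) (F : Finset V) : Set (T ≃g T) :=
  {g | ∀ x ∈ F, g x = g₀ x}

/-- The permutation topology on `Aut(T)`. -/
instance permutationTopology : TopologicalSpace (T ≃g T) :=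
  TopologicalSpace.generateFrom {U | ∃ (g₀ : T ≃g T) (F : Finset V), U = basicSet g₀ F}

/-- A set of automorphisms is open if and only if it is a union of basic sets. -/
theorem isOpen_iff {U : Set (T ≃g T)} :
    IsOpen U ↔ ∀ g ∈ U, ∃ F : Finset V, basicSet g F ⊆ U := by
  classical
  constructor
  · intro h
    induction h with
    | basic s hs =>
      obtain ⟨g₀, F, rfl⟩ := hs
      intro g hg
      exact ⟨F, fun x hx y hy => (hx y hy).trans (hg y hy)⟩
    | univ => exact fun g _ => ⟨∅, Set.subset_univ _⟩
    | inter s t _ _ hs ht =>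
      rintro g ⟨h1, h2⟩
      obtain ⟨F1, hF1⟩ := hs g h1
      obtain ⟨F2, hF2⟩ := ht g h2
      exact ⟨F1 ∪ F2, fun x hx =>
        ⟨hF1 fun y hy => hx y (Finset.mem_union_left _ hy),
          hF2 fun y hy => hx y (Finset.mem_union_right _ hy)⟩⟩
    | sUnion S _ ih =>
      rintro g ⟨s, hs, hg⟩
      obtain ⟨F, hF⟩ := ih s hs g hg
      exact ⟨F, hF.trans (Set.subset_sUnion_of_mem hs)⟩
  · intro h
    choose! F hF using h
    have hU : U = ⋃₀ {W | ∃ g ∈ U, W = basicSet g (F g)} := by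
      ext g
      constructor
      · exact fun hg => ⟨_, ⟨g, hg, rfl⟩, fun _ _ => rfl⟩
      · rintro ⟨_, ⟨g', hg', rfl⟩, hg⟩
        exact hF g' hg' hg
    rw [hU]
    refine isOpen_sUnion ?_
    rintro _ ⟨g, _, rfl⟩
    exact TopologicalSpace.isOpen_generateFrom_of_mem ⟨g, _, rfl⟩

theorem mem_nhds_iff_basicSet {g : T ≃g T} {U : Set (T ≃g T)} :
    U ∈ nhds g ↔ ∃ F : Finset V, basicSet g F ⊆ U := by
  rw [mem_nhds_iff]
  constructor
  · rintro ⟨W, hWU, hW, hg⟩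
    obtain ⟨F, hF⟩ := isOpen_iff.1 hW g hg
    exact ⟨F, hF.trans hWU⟩
  · rintro ⟨F, hF⟩
    exact ⟨_, hF, TopologicalSpace.isOpen_generateFrom_of_mem ⟨g, F, rfl⟩, fun _ _ => rfl⟩

/-- `Aut(T)` with the permutation topology is a topological group. -/
instance isTopologicalGroup_aut : IsTopologicalGroup (T ≃g T) where
  continuous_mul := by
    classical
    rw [continuous_iff_continuousAt]
    rintro ⟨g, h⟩ U hU
    obtain ⟨F, hF⟩ := mem_nhds_iff_basicSet.1 hU
    rw [Filter.mem_map, nhds_prod_eq]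
    refine Filter.mem_of_superset (Filter.prod_mem_prod
      (mem_nhds_iff_basicSet.2 ⟨F.image h, subset_rfl⟩)
      (mem_nhds_iff_basicSet.2 ⟨F, subset_rfl⟩)) ?_
    rintro ⟨a, b⟩ ⟨ha, hb⟩
    refine hF fun x hx => ?_
    change a (b x) = g (h x)
    rw [hb x hx]
    exact ha _ (Finset.mem_image_of_mem _ hx)
  continuous_inv := by
    classical
    rw [continuous_iff_continuousAt]
    rintro g U hU
    obtain ⟨F, hF⟩ := mem_nhds_iff_basicSet.1 hU
    rw [Filter.mem_map]
    refine mem_nhds_iff_basicSet.2 ⟨F.image (g⁻¹ : T ≃g T), ?_⟩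
    intro a ha
    refine hF fun x hx => ?_
    have h1 : a ((g⁻¹ : T ≃g T) x) = g ((g⁻¹ : T ≃g T) x) :=
      ha _ (Finset.mem_image_of_mem _ hx)
    have h2 : g ((g⁻¹ : T ≃g T) x) = x := g.apply_symm_apply x
    change a.symm x = (g⁻¹ : T ≃g T) x
    rw [RelIso.symm_apply_eq, h1, h2]

/-- The fixator `Fix_G(Y)`: the elements of `G` that fix every vertex of `Y`. -/
def fixator (G : Subgroup (T ≃g T)) (Y : Set V) : Subgroup (T ≃g T) where
  carrier := {g | g ∈ G ∧ ∀ y ∈ Y, g y = y}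
  mul_mem' {a b} ha hb := ⟨G.mul_mem ha.1 hb.1, fun y hy => by
    change a (b y) = y
    rw [hb.2 y hy, ha.2 y hy]⟩
  one_mem' := ⟨G.one_mem, fun _ _ => rfl⟩
  inv_mem' {a} ha := ⟨G.inv_mem ha.1, fun y hy => by
    change a.symm y = y
    rw [RelIso.symm_apply_eq, ha.2 y hy]⟩

variable (T) in
/-- The ball `B(v, n)` in the tree. -/
def ball (v : V) (n : ℕ) : Set V := {u | T.dist v u ≤ n}

variable (T) in
/-- The half-tree `T_(v,w)`: the vertices in the component of `w` after removing the
edge `{v, w}`. -/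
def halfTree (v w : V) : Set V := {u | (T.deleteEdges {s(v, w)}).Reachable w u}

/-- `F_{k,e}` for the edge `e = {v, w}`. -/
def edgeFixator (G : Subgroup (T ≃g T)) (k : ℕ) (v w : V) : Subgroup (T ≃g T) :=
  fixator G (ball T v k ∩ ball T w k)

/-- `G^{+_k}`: the subgroup generated by all `F_{k,e}`, `e` an edge. -/
def plusGroup (G : Subgroup (T ≃g T)) (k : ℕ) : Subgroup (T ≃g T) :=
  Subgroup.closure {g | ∃ v w : V, T.Adj v w ∧ g ∈ edgeFixator G k v w}

/-- Property `P_k`: for every edge `{v, w}`, the group `F_{k,e}` is the product of its subgroups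
fixing one of the two half-trees pointwise. -/
def PropertyP (G : Subgroup (T ≃g T)) (k : ℕ) : Prop :=
  ∀ v w : V, T.Adj v w →
    (edgeFixator G k v w : Set (T ≃g T)) =
      (fixator (edgeFixator G k v w) (halfTree T v w) : Set (T ≃g T)) *
        (fixator (edgeFixator G k v w) (halfTree T w v) : Set (T ≃g T))

/-- `G` stabilises a proper non-empty subtree. A subtree of a tree is given by its vertex set `S`,
which has to span a connected subgraph (connectedness includes that `S` is non-empty). -/
def StabilisesProperSubtree (G : Subgroup (T ≃g T)) : Prop :=
  ∃ S : Set V, (T.induce S).Connected ∧ S ≠ Set.univ ∧ ∀ g ∈ G, g '' S = S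

variable (T) in
/-- A ray: a one-sided infinite path without repeated vertices. -/
structure Ray where
  /-- the sequence of vertices -/
  vert : ℕ → V
  adj : ∀ n, T.Adj (vert n) (vert (n + 1))
  inj : Function.Injective vert

/-- The image of a ray under an automorphism. -/
def Ray.map (g : T ≃g T) (r : Ray T) : Ray T where
  vert n := g (r.vert n)
  adj n := g.map_rel_iff.2 (r.adj n)
  inj := g.injective.comp r.inj

variable (T) in
/-- Two rays of a tree are equivalent if their intersection is again a ray, that is, if they
have a common tail. -/
def raySetoid : Setoid (Ray T) where
  r a b := ∃ m n : ℕ, ∀ i, a.vert (m + i) = b.vert (n + i)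
  iseqv :=
    { refl := fun _ => ⟨0, 0, fun _ => rfl⟩
      symm := fun ⟨m, n, h⟩ => ⟨n, m, fun i => (h i).symm⟩
      trans := fun {a b c} ⟨m, n, h⟩ ⟨m', n', h'⟩ => ⟨m + m', n' + n, fun i => by
        have h1 := h (m' + i)
        have h2 := h' (n + i)
        have e : n + (m' + i) = m' + (n + i) := by omega
        rw [add_assoc, add_assoc, h1, e, h2]⟩ }

variable (T) in
/-- The boundary of `T`, whose elements are the ends of `T`. -/
def Boundary : Type u := Quotient (raySetoid T)

/-- The action of an automorphism on the ends. -/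
def Boundary.map (g : T ≃g T) : Boundary T → Boundary T :=
  Quotient.map' (s₁ := raySetoid T) (s₂ := raySetoid T) (Ray.map g)
    fun _ _ ⟨m, n, h⟩ => ⟨m, n, fun i => congrArg g (h i)⟩

/-- `G` fixes an end of `T`. -/
def FixesEnd (G : Subgroup (T ≃g T)) : Prop :=
  ∃ ξ : Boundary T, ∀ g ∈ G, Boundary.map g ξ = ξ

/-- The closed range property: every continuous homomorphism to a (Hausdorff) topological group
has closed range. -/
def ClosedRangeProperty (G : Type u) [Group G] [TopologicalSpace G] [IsTopologicalGroup G] :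
    Prop :=
  ∀ (H : Type v) [Group H] [TopologicalSpace H] [IsTopologicalGroup H] [T2Space H]
    (φ : G →* H), Continuous φ → IsClosed (Set.range φ)

end TreeAut

namespace TreeAut

variable {V : Type u} {T : SimpleGraph V}

/-! ### Half-trees -/

/-! Write N for `plusGroup G k`, a subgroup normalised by `G`. If N fixes a vertex, its fixed
vertices form a `G`-invariant subtree, so N is trivial (`eq_one_of_fixes_vertex`). Otherwise take a
limit point h of the range of φ and an ultrafilter on N along which φ tends to h.

If the ultrafilter eventually sends some vertex to a constant vertex, local finiteness and
closedness of N make it converge in N (`exists_nhds_of_eventually_apply_eq`), and φ sends its limit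
to h.

If it escapes, the images of a vertex tend to an end, recorded as an orientation `f` of all edges.
An element u that fixes a half-tree containing that end is contracted to 1 by the conjugations along
the ultrafilter, while the φ-images of its conjugates tend to h⁻¹ φ(u) h; hence φ(u) = 1. By
Property P, elements fixing half-trees generate N. Each of their half-trees can be moved by N so as
to contain the end (`exists_map_orientation`), so φ is trivial and its range is closed.

Moving the half-trees rests on `convex_eq_univ`: N inherits from `G` the absence of proper invariant
subtrees. It is applied to sets of vertices at which translated orientations disagree, which are
convex. -/

theorem adj_induction (hT : T.IsTree) {P : V → Prop} {x : V} (h0 : P x)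
    (step : ∀ p q, T.Adj p q → P p → P q) (z : V) : P z := by
  have h := (SimpleGraph.reachable_iff_reflTransGen x z).1 (hT.1.preconnected x z)
  induction h with
  | refl => exact h0
  | tail _ hpq ih => exact step _ _ hpq ih

theorem self_mem_halfTree (x y : V) : y ∈ halfTree T x y := SimpleGraph.Reachable.refl _

theorem notMem_halfTree (hT : T.IsTree) {x y : V} (h : T.Adj x y) : x ∉ halfTree T x y := fun hx =>
  SimpleGraph.isBridge_iff.1
    (SimpleGraph.isAcyclic_iff_forall_adj_isBridge.1 hT.2 h) (SimpleGraph.Reachable.symm hx)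

/-- The deleted edge is the only edge that leaves a half-tree. Most arguments about half-trees below
reduce to this. -/
theorem halfTree_crossing (hT : T.IsTree) {x y p q : V} (h : T.Adj x y) (hpq : T.Adj p q)
    (hp : p ∈ halfTree T x y) (hq : q ∉ halfTree T x y) : p = y ∧ q = x := by
  by_cases he : s(p, q) = s(x, y)
  · rcases Sym2.eq_iff.1 he with ⟨rfl, rfl⟩ | h
    · exact absurd hp (notMem_halfTree hT h)
    · exact h
  · refine absurd (SimpleGraph.Reachable.trans hp (SimpleGraph.Adj.reachable ?_)) hq
    rw [SimpleGraph.deleteEdges_adj]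
    exact ⟨hpq, he⟩

theorem halfTree_induction {x y : V} {P : V → Prop} (h0 : P y)
    (step : ∀ p q, p ∈ halfTree T x y → q ∈ halfTree T x y → T.Adj p q → P p → P q)
    {z : V} (hz : z ∈ halfTree T x y) : P z := by
  have hz' := (SimpleGraph.reachable_iff_reflTransGen y z).1 hz
  suffices z ∈ halfTree T x y ∧ P z from this.2
  clear hz
  induction hz' with
  | refl => exact ⟨self_mem_halfTree x y, h0⟩
  | @tail p q _ hpq ih =>
    have hq : q ∈ halfTree T x y := SimpleGraph.Reachable.trans ih.1 hpq.reachable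
    rw [SimpleGraph.deleteEdges_adj] at hpq
    exact ⟨hq, step p q ih.1 hq hpq.1 ih.2⟩

theorem mem_halfTree_or (hT : T.IsTree) {x y : V} (h : T.Adj x y) (z : V) :
    z ∈ halfTree T x y ∨ z ∈ halfTree T y x := by
  refine adj_induction hT (P := fun z => z ∈ halfTree T x y ∨ z ∈ halfTree T y x)
    (Or.inl (self_mem_halfTree x y)) ?_ z
  intro p q hpq hp
  by_contra! hq
  rcases hp with hp | hp
  · obtain ⟨-, rfl⟩ := halfTree_crossing hT h hpq hp hq.1
    exact hq.2 (self_mem_halfTree _ _)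
  · obtain ⟨-, rfl⟩ := halfTree_crossing hT h.symm hpq hp hq.2
    exact hq.1 (self_mem_halfTree _ _)

theorem eq_of_adj_of_mem_halfTree (hT : T.IsTree) {x y w : V} (h : T.Adj x y) (hw : T.Adj x w)
    (hm : w ∈ halfTree T x y) : w = y :=
  (halfTree_crossing hT h hw.symm hm (notMem_halfTree hT h)).1

/-- A half-tree at `z` pointing away from `s` lies in the half-tree at `s` containing `z`. -/
theorem halfTree_subset (hT : T.IsTree) {z y s t : V} (hzy : T.Adj z y) (hst : T.Adj s t)
    (hs : s ∉ halfTree T z y) (hz : z ∈ halfTree T s t) : halfTree T z y ⊆ halfTree T s t := by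
  intro x hx
  refine halfTree_induction (P := fun x => x ∈ halfTree T s t) ?_ ?_ hx
  · by_contra hy
    obtain ⟨-, rfl⟩ := halfTree_crossing hT hst hzy hz hy
    exact hs (self_mem_halfTree _ _)
  · intro p q _ hq hpq hp
    by_contra hq'
    obtain ⟨-, rfl⟩ := halfTree_crossing hT hst hpq hp hq'
    exact hs hq

theorem halfTree_subset_opposite (hT : T.IsTree) {x y y' : V} (h : T.Adj x y) (h' : T.Adj x y')
    (hne : y ≠ y') : halfTree T x y ⊆ halfTree T y' x :=
  halfTree_subset hT h h'.symm (fun hm => hne (eq_of_adj_of_mem_halfTree hT h h' hm).symm)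
    (self_mem_halfTree _ _)

theorem notMem_halfTree_opposite (hT : T.IsTree) {x y z : V} (h : T.Adj x y)
    (hz : z ∈ halfTree T x y) : z ∉ halfTree T y x := by
  refine halfTree_induction (P := fun z => z ∉ halfTree T y x)
    (notMem_halfTree hT h.symm) ?_ hz
  intro p q _ hq hpq hpn hq'
  exact notMem_halfTree hT h ((halfTree_crossing hT h.symm hpq.symm hq' hpn).1 ▸ hq)

theorem halfTree_unique (hT : T.IsTree) {x y y' z : V} (h : T.Adj x y) (h' : T.Adj x y')
    (hz : z ∈ halfTree T x y) (hz' : z ∈ halfTree T x y') : y = y' := by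
  by_contra hne
  exact notMem_halfTree_opposite hT h' hz' (halfTree_subset_opposite hT h h' hne hz)

theorem exists_mem_halfTree (hT : T.IsTree) {x z : V} (hne : z ≠ x) :
    ∃ y, T.Adj x y ∧ z ∈ halfTree T x y := by
  refine (adj_induction hT (P := fun z => z = x ∨ ∃ y, T.Adj x y ∧ z ∈ halfTree T x y)
    (x := x) (Or.inl rfl) ?_ z).resolve_left hne
  rintro p q hpq (rfl | ⟨y, hy, hp⟩)
  · exact Or.inr ⟨q, hpq, self_mem_halfTree _ _⟩
  · by_cases hq : q ∈ halfTree T x y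
    · exact Or.inr ⟨y, hy, hq⟩
    · exact Or.inl (halfTree_crossing hT hy hpq hp hq).2

theorem map_mem_halfTree (g : T ≃g T) {x y z : V} (hz : z ∈ halfTree T x y) :
    g z ∈ halfTree T (g x) (g y) := by
  have hz' := (SimpleGraph.reachable_iff_reflTransGen y z).1 hz
  clear hz
  induction hz' with
  | refl => exact self_mem_halfTree _ _
  | @tail p q _ hpq ih =>
    refine SimpleGraph.Reachable.trans ih (SimpleGraph.Adj.reachable ?_)
    rw [SimpleGraph.deleteEdges_adj] at hpq ⊢
    refine ⟨g.map_rel_iff.2 hpq.1, fun h => hpq.2 ?_⟩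
    simpa [Sym2.eq_iff, g.injective.eq_iff] using h

theorem map_mem_halfTree_iff (g : T ≃g T) {x y z : V} :
    g z ∈ halfTree T (g x) (g y) ↔ z ∈ halfTree T x y := by
  refine ⟨fun h => ?_, map_mem_halfTree g⟩
  simpa using map_mem_halfTree g⁻¹ h

theorem mem_halfTree_of_walk {z q y : V} (r : T.Walk q y)
    (hz : z ∉ r.support) : y ∈ halfTree T z q := by
  refine (r.toDeleteEdge s(z, q) fun he => hz ?_).reachable
  exact r.fst_mem_support_of_mem_edges he

/-! ### Convex sets of vertices -/

variable (T) in
/-- A set of vertices is convex if each vertex outside sees it in a single direction. -/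
def IsConvex (S : Set V) : Prop :=
  ∀ z ∉ S, ∃ y, T.Adj z y ∧ S ⊆ halfTree T z y

theorem IsConvex.induce_connected (hT : T.IsTree) {S : Set V} (hS : IsConvex T S)
    (hne : S.Nonempty) : (T.induce S).Connected := by
  have key : ∀ (x y : V) (p : T.Walk x y), p.IsPath → ∀ (hx : x ∈ S) (hy : y ∈ S),
      (T.induce S).Reachable ⟨x, hx⟩ ⟨y, hy⟩ := by
    intro x y p
    induction p with
    | nil => exact fun _ _ _ => SimpleGraph.Reachable.refl _
    | @cons x q y hxq r ih =>
      intro hp hx hy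
      rw [SimpleGraph.Walk.cons_isPath_iff] at hp
      by_cases hq : q ∈ S
      · refine SimpleGraph.Reachable.trans (SimpleGraph.Adj.reachable ?_) (ih hp.1 hq hy)
        exact hxq
      · exfalso
        cases r with
        | nil => exact hq hy
        | @cons _ q2 _ h2 r' =>
          -- The path leaves `S` at `q`, but `x` and the endpoint `y` are seen from `q` in the same
          -- direction, so the path would have to backtrack to `x`.
          rw [SimpleGraph.Walk.cons_isPath_iff] at hp
          obtain ⟨w, hw, hSw⟩ := hS q hq
          have h3 : w = x := halfTree_unique hT hw hxq.symm (hSw hx) (self_mem_halfTree _ _)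
          have h4 : w = q2 :=
            halfTree_unique hT hw h2 (hSw hy) (mem_halfTree_of_walk r' hp.1.2)
          apply hp.2
          rw [← h3, h4, SimpleGraph.Walk.support_cons]
          exact List.mem_cons_of_mem _ r'.start_mem_support
  have : Nonempty S := hne.to_subtype
  refine SimpleGraph.Connected.mk fun a b => ?_
  obtain ⟨p, hp⟩ := hT.1.exists_isPath a.1 b.1
  exact key _ _ p hp a.2 b.2

theorem IsConvex.iInter {ι : Type*} {S : ι → Set V} (h : ∀ i, IsConvex T (S i)) :
    IsConvex T (⋂ i, S i) := by
  intro z hz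
  rw [Set.mem_iInter, not_forall] at hz
  obtain ⟨i, hi⟩ := hz
  obtain ⟨y, hy, hS⟩ := h i z hi
  exact ⟨y, hy, (Set.iInter_subset _ _).trans hS⟩

theorem IsConvex.image (g : T ≃g T) {S : Set V} (h : IsConvex T S) : IsConvex T (g '' S) := by
  intro z hz
  obtain ⟨y, hy, hS⟩ := h (g⁻¹ z) fun hm => hz ⟨_, hm, by simp⟩
  refine ⟨g y, ?_, ?_⟩
  · have := g.map_rel_iff.2 hy
    simpa using this
  · rintro _ ⟨s, hs, rfl⟩
    have := map_mem_halfTree g (hS hs)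
    simpa using this

/-- Two disjoint convex sets are joined by a bridge. -/
theorem exists_bridge (hT : T.IsTree) {A B : Set V} (hB : IsConvex T B)
    (hAn : A.Nonempty) (hBn : B.Nonempty) (hAB : Disjoint A B) :
    ∃ a q, T.Adj a q ∧ a ∈ A ∧ q ∉ A ∧ B ⊆ halfTree T a q := by
  have key : ∀ (x y : V) (p : T.Walk x y), p.IsPath → x ∈ A → y ∉ A →
      ∃ a q, T.Adj a q ∧ a ∈ A ∧ q ∉ A ∧ y ∈ halfTree T a q := by
    intro x y p
    induction p with
    | nil => exact fun _ h h' => absurd h h'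
    | @cons x q y hxq r ih =>
      intro hp hx hy
      rw [SimpleGraph.Walk.cons_isPath_iff] at hp
      by_cases hq : q ∈ A
      · exact ih hp.1 hq hy
      · exact ⟨x, q, hxq, hx, hq, mem_halfTree_of_walk r hp.2⟩
  obtain ⟨x, hx⟩ := hAn
  obtain ⟨y, hy⟩ := hBn
  obtain ⟨p, hp⟩ := hT.1.exists_isPath x y
  obtain ⟨a, q, haq, ha, hq, hya⟩ := key x y p hp hx (Set.disjoint_right.1 hAB hy)
  obtain ⟨w, hw, hBw⟩ := hB a (Set.disjoint_left.1 hAB ha)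
  obtain rfl := halfTree_unique hT hw haq (hBw hy) hya
  exact ⟨a, w, haq, ha, hq, hBw⟩

/-- With two different starting points, convexity of `A` would place each behind the other's bridge,
so the bridges would point away from each other and could not both lead to `B`. Uniqueness forces
automorphisms preserving `A` and `B` to fix the starting point. -/
theorem bridge_unique (hT : T.IsTree) {A B : Set V} (hA : IsConvex T A) (hBn : B.Nonempty)
    {a q a' q' : V} (haq : T.Adj a q) (ha : a ∈ A) (hq : q ∉ A) (hB : B ⊆ halfTree T a q)
    (haq' : T.Adj a' q') (ha' : a' ∈ A) (hq' : q' ∉ A) (hB' : B ⊆ halfTree T a' q') :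
    a = a' := by
  have sub : ∀ {a q : V}, T.Adj a q → a ∈ A → q ∉ A → A ⊆ halfTree T q a := by
    intro a q haq ha hq
    obtain ⟨w, hw, hAw⟩ := hA q hq
    obtain rfl := halfTree_unique hT hw haq.symm (hAw ha) (self_mem_halfTree _ _)
    exact hAw
  by_contra hne
  obtain ⟨t, ht, hat⟩ := exists_mem_halfTree hT hne
  have h1 : halfTree T a q ⊆ halfTree T a' t :=
    halfTree_subset hT haq ht
      (fun h => notMem_halfTree_opposite hT haq h (sub haq ha hq ha')) hat
  obtain ⟨b, hb⟩ := hBn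
  obtain rfl := halfTree_unique hT ht haq' (h1 (hB hb)) (hB' hb)
  exact notMem_halfTree_opposite hT ht hat (sub haq' ha' hq' ha)

/-! ### Orientations towards an end -/

variable (T) in
/-- A map sending each vertex to the neighbour that leads to some fixed end. -/
structure IsOrientation (f : V → V) : Prop where
  adj : ∀ x, T.Adj x (f x)
  ne : ∀ x, f (f x) ≠ x
  or : ∀ x y, T.Adj x y → f x = y ∨ f y = x

namespace IsOrientation

variable {f : V → V}

theorem iterate_mem_halfTree (hT : T.IsTree) (hf : IsOrientation T f) (x : V) (n : ℕ) :
    f^[n + 1] x ∈ halfTree T x (f x) := by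
  induction n with
  | zero => exact self_mem_halfTree _ _
  | succ n ih =>
    rw [Function.iterate_succ_apply']
    by_contra h
    obtain ⟨h1, h2⟩ := halfTree_crossing hT (hf.adj x) (hf.adj _) ih h
    rw [h1] at h2
    exact hf.ne x h2

theorem exists_iterate_eq (hT : T.IsTree) (hf : IsOrientation T f) (x y : V) :
    ∃ m n, f^[m] x = f^[n] y := by
  refine adj_induction hT (P := fun y => ∃ m n, f^[m] x = f^[n] y) (x := x) ⟨0, 0, rfl⟩ ?_ y
  rintro p q hpq ⟨m, n, h⟩
  rcases hf.or p q hpq with rfl | rfl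
  · exact ⟨m + 1, n, by
      rw [Function.iterate_succ_apply', h]
      exact (Function.iterate_succ_apply' f n p).symm.trans (Function.iterate_succ_apply f n p)⟩
  · exact ⟨m, n + 1, by rw [h, Function.iterate_succ_apply]⟩

/-- The ray that follows an orientation. -/
def ray (hT : T.IsTree) (hf : IsOrientation T f) (x : V) : Ray T where
  vert n := f^[n] x
  adj n := by
    rw [Function.iterate_succ_apply']
    exact hf.adj _
  inj := by
    have key : ∀ m n, m < n → f^[m] x ≠ f^[n] x := by
      intro m n hmn h
      obtain ⟨d, rfl⟩ := Nat.exists_eq_add_of_lt hmn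
      have h1 := hf.iterate_mem_halfTree hT (f^[m] x) d
      rw [← Function.iterate_add_apply, show d + 1 + m = m + d + 1 by omega, ← h] at h1
      exact notMem_halfTree hT (hf.adj _) h1
    intro m n h
    rcases lt_trichotomy m n with hmn | hmn | hmn
    · exact absurd h (key m n hmn)
    · exact hmn
    · exact absurd h.symm (key n m hmn)

/-- Any two vertices have forward orbits that merge, so the ray from `x` and its image, the ray from
`g x`, share a tail. -/
theorem fixesEnd (hT : T.IsTree) (hf : IsOrientation T f) {G : Subgroup (T ≃g T)}
    (hG : ∀ g ∈ G, ∀ x, g (f x) = f (g x)) : FixesEnd G := by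
  have : Nonempty V := hT.1.nonempty
  let x : V := Classical.arbitrary V
  refine ⟨Quotient.mk (raySetoid T) (hf.ray hT x), fun g hg => ?_⟩
  refine Quotient.sound (s := raySetoid T) ?_
  obtain ⟨m, n, h⟩ := hf.exists_iterate_eq hT (g x) x
  refine ⟨m, n, fun i => ?_⟩
  change g (f^[m + i] x) = f^[n + i] x
  have h1 : ∀ j, g (f^[j] x) = f^[j] (g x) := by
    intro j
    induction j with
    | zero => rfl
    | succ j ih => rw [Function.iterate_succ_apply', hG g hg, ih, Function.iterate_succ_apply']
  rw [h1, add_comm m, add_comm n, Function.iterate_add_apply, h, Function.iterate_add_apply]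

/-- Seen from `s`, the end lies beyond `z`: the forward orbit of `z` stays in the half-tree at `s`
towards `z`, and the forward orbit of `s` eventually joins it. -/
theorem apply_eq_of_notMem (hT : T.IsTree) (hf : IsOrientation T f) {z s t : V}
    (hst : T.Adj s t) (hs : s ∉ halfTree T z (f z)) (hz : z ∈ halfTree T s t) : f s = t := by
  by_contra hne
  have h1 := halfTree_subset hT (hf.adj z) hst hs hz
  obtain ⟨m, n, h⟩ := hf.exists_iterate_eq hT z s
  have h2 := h1 (hf.iterate_mem_halfTree hT z m)
  have h3 := hf.iterate_mem_halfTree hT s n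
  rw [Function.iterate_succ_apply', h, ← Function.iterate_succ_apply' f] at h2
  exact hne (halfTree_unique hT (hf.adj s) hst h3 h2)

/-- Where all orientations agree at `z`, every vertex behind `z` must point towards `z` in all of
them. Disagreement can only occur ahead of `z`. -/
theorem isConvex_disagree (hT : T.IsTree) {ι : Type*} [Nonempty ι] {f : ι → V → V}
    (hf : ∀ i, IsOrientation T (f i)) : IsConvex T {x | ∃ i j, f i x ≠ f j x} := by
  intro z hz
  simp only [Set.mem_ofPred_eq, not_exists, not_not] at hz
  let i0 : ι := Classical.arbitrary ι
  refine ⟨f i0 z, (hf i0).adj z, ?_⟩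
  rintro s ⟨i, j, hij⟩
  by_contra hs
  have hne : z ≠ s := by
    rintro rfl
    exact hij (hz i j)
  obtain ⟨t, ht, hzt⟩ := exists_mem_halfTree hT hne
  have key : ∀ i, f i s = t := fun i =>
    (hf i).apply_eq_of_notMem hT ht (by rwa [hz i i0]) hzt
  exact hij ((key i).trans (key j).symm)

theorem conj (hf : IsOrientation T f) (g : T ≃g T) :
    IsOrientation T fun x => g (f (g⁻¹ x)) where
  adj x := by
    have := g.map_rel_iff.2 (hf.adj (g⁻¹ x))
    simpa using this
  ne x h := by
    apply hf.ne (g⁻¹ x)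
    apply g.injective
    simpa using h
  or x y hxy := by
    have := hf.or (g⁻¹ x) (g⁻¹ y) ((g⁻¹).map_rel_iff.2 hxy)
    refine this.imp (fun h => ?_) (fun h => ?_) <;> rw [h] <;> simp

end IsOrientation

/-! ### Normalised subgroups -/

section Normal

variable {G N : Subgroup (T ≃g T)}

theorem eq_one_of_fixes_vertex (hT : T.IsTree) (hG : ¬ StabilisesProperSubtree G)
    (hconj : ∀ g ∈ G, ∀ n ∈ N, g * n * g⁻¹ ∈ N) {x : V} (hx : ∀ n ∈ N, n x = x) :
    ∀ n ∈ N, n = 1 := by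
  have hmap : ∀ g ∈ G, ∀ y, (∀ n ∈ N, n y = y) → ∀ n ∈ N, n (g y) = g y := by
    intro g hg y hy n hn
    have h1 := hy _ (hconj g⁻¹ (G.inv_mem hg) n hn)
    apply (g⁻¹).injective
    simpa using h1
  by_contra hne
  refine hG ⟨{y | ∀ n ∈ N, n y = y}, ?_, ?_, ?_⟩
  · have : Nonempty {y | ∀ n ∈ N, n y = y} := ⟨⟨x, hx⟩⟩
    refine SimpleGraph.Connected.mk fun a b => ?_
    obtain ⟨p, hp⟩ := hT.1.exists_isPath a.1 b.1
    refine ⟨p.induce {y | ∀ n ∈ N, n y = y} ?_⟩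
    intro y hy n hn
    -- Paths in a tree are unique, so `n` maps the path between two of its fixed points to itself
    -- vertex by vertex.
    have hp' : ((p.map n.toHom).copy (a.2 n hn) (b.2 n hn)).IsPath := by
      simpa using hp.map n.injective
    have h1 : ((p.map n.toHom).copy (a.2 n hn) (b.2 n hn)) = p :=
      congrArg Subtype.val ((hT.2.subsingleton_path a.1 b.1).elim ⟨_, hp'⟩ ⟨p, hp⟩)
    have h2 := congrArg SimpleGraph.Walk.support h1
    rw [SimpleGraph.Walk.support_copy, SimpleGraph.Walk.support_map] at h2
    have h3 : p.support.map n.toHom = p.support.map id := by rw [h2, List.map_id]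
    exact List.map_inj_left.1 h3 y hy
  · intro h
    apply hne
    intro n hn
    ext y
    have : y ∈ {y | ∀ n ∈ N, n y = y} := h ▸ Set.mem_univ y
    exact this n hn
  · intro g hg
    ext y
    constructor
    · rintro ⟨z, hz, rfl⟩
      exact hmap g hg z hz
    · exact fun hy => ⟨g⁻¹ y, hmap _ (G.inv_mem hg) y hy, by simp⟩

/-- The `G`-translates of `S` are again `N`-invariant and meet pairwise. Their intersection is a
`G`-invariant subtree if non-empty; if it is empty, the directions in which vertices see the
translates missing them define a `G`-fixed end. -/
theorem convex_eq_univ (hT : T.IsTree) (hG : ¬ StabilisesProperSubtree G) (hend : ¬ FixesEnd G)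
    (hconj : ∀ g ∈ G, ∀ n ∈ N, g * n * g⁻¹ ∈ N) (hfix : ∀ x, ∃ n ∈ N, n x ≠ x)
    {S : Set V} (hS : IsConvex T S) (hne : S.Nonempty) (hinv : ∀ n ∈ N, ∀ x ∈ S, n x ∈ S) :
    S = Set.univ := by
  have hinv' : ∀ g ∈ G, ∀ n ∈ N, ∀ x ∈ g '' S, n x ∈ g '' S := by
    rintro g hg n hn _ ⟨x, hx, rfl⟩
    refine ⟨_, hinv _ (hconj g⁻¹ (G.inv_mem hg) n hn) x hx, ?_⟩
    simp
  have hmeet : ∀ g ∈ G, ∀ g' ∈ G, (g '' S ∩ g' '' S).Nonempty := by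
    intro g hg g' hg'
    by_contra hdis
    rw [Set.not_nonempty_iff_eq_empty, ← Set.disjoint_iff_inter_eq_empty] at hdis
    obtain ⟨a, q, haq, ha, hq, hB⟩ :=
      exists_bridge hT (hS.image g') (hne.image g) (hne.image g') hdis
    obtain ⟨n, hn, hna⟩ := hfix a
    -- `n` preserves both translates and so maps the bridge to a bridge between them; uniqueness
    -- makes `a` a fixed point.
    refine hna (bridge_unique hT (hS.image g) (hne.image g') (n.map_rel_iff.2 haq)
      (hinv' g hg n hn a ha) (q := n q) ?_ ?_ haq ha hq hB)
    · intro h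
      apply hq
      simpa using hinv' g hg n⁻¹ (N.inv_mem hn) _ h
    · intro b hb
      have := map_mem_halfTree n (hB (hinv' g' hg' n⁻¹ (N.inv_mem hn) b hb))
      simpa using this
  by_cases hI : (⋂ g : G, (g : T ≃g T) '' S).Nonempty
  · have hconv : IsConvex T (⋂ g : G, (g : T ≃g T) '' S) := IsConvex.iInter fun g => hS.image _
    have hmap : ∀ g ∈ G, ∀ y ∈ (⋂ g : G, (g : T ≃g T) '' S),
        g y ∈ (⋂ g : G, (g : T ≃g T) '' S) := by
      intro g hg y hy
      rw [Set.mem_iInter] at hy ⊢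
      intro c
      obtain ⟨s, hs, h⟩ := hy (⟨g, hg⟩⁻¹ * c)
      refine ⟨s, hs, ?_⟩
      rw [← h]
      simp
    have huniv : (⋂ g : G, (g : T ≃g T) '' S) = Set.univ := by
      by_contra hnu
      refine hG ⟨_, hconv.induce_connected hT hI, hnu, fun g hg => ?_⟩
      ext y
      constructor
      · rintro ⟨z, hz, rfl⟩
        exact hmap g hg z hz
      · exact fun hy => ⟨g⁻¹ y, hmap _ (G.inv_mem hg) y hy, by simp⟩
    refine Set.eq_univ_of_forall fun x => ?_
    have hx : x ∈ (⋂ g : G, (g : T ≃g T) '' S) := huniv ▸ Set.mem_univ x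
    obtain ⟨s, hs, h⟩ := Set.mem_iInter.1 hx 1
    obtain rfl : s = x := h
    exact hs
  · exfalso
    have hex : ∀ x, ∃ y, T.Adj x y ∧ ∃ g ∈ G, g '' S ⊆ halfTree T x y := by
      intro x
      have hx : x ∉ (⋂ g : G, (g : T ≃g T) '' S) := fun h => hI ⟨x, h⟩
      rw [Set.mem_iInter, not_forall] at hx
      obtain ⟨g, hg⟩ := hx
      obtain ⟨y, hy, h⟩ := hS.image (g : T ≃g T) x hg
      exact ⟨y, hy, g, g.2, h⟩
    have huniq : ∀ x y y', T.Adj x y → T.Adj x y' → (∃ g ∈ G, g '' S ⊆ halfTree T x y) →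
        (∃ g ∈ G, g '' S ⊆ halfTree T x y') → y = y' := by
      rintro x y y' h h' ⟨g, hg, hgS⟩ ⟨g', hg', hgS'⟩
      obtain ⟨z, hz, hz'⟩ := hmeet g hg g' hg'
      exact halfTree_unique hT h h' (hgS hz) (hgS' hz')
    choose f hfadj hf using hex
    have hor : IsOrientation T f := by
      refine ⟨hfadj, fun x h => ?_, fun x y hxy => ?_⟩
      · obtain ⟨g, hg, hgS⟩ := hf x
        obtain ⟨g', hg', hgS'⟩ := hf (f x)
        obtain ⟨z, hz, hz'⟩ := hmeet g hg g' hg'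
        rw [h] at hgS'
        exact notMem_halfTree_opposite hT (hfadj x) (hgS hz) (hgS' hz')
      · by_cases h : f x = y
        · exact Or.inl h
        · obtain ⟨g, hg, hgS⟩ := hf x
          exact Or.inr (huniq y _ _ (hfadj y) hxy.symm (hf y)
            ⟨g, hg, hgS.trans (halfTree_subset_opposite hT (hfadj x) hxy h)⟩)
    refine hend (hor.fixesEnd hT fun g hg x => ?_)
    refine huniq (g x) _ _ (g.map_rel_iff.2 (hfadj x)) (hfadj _) ?_ (hf _)
    obtain ⟨c, hc, hcS⟩ := hf x
    refine ⟨g * c, G.mul_mem hg hc, ?_⟩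
    rintro _ ⟨s, hs, rfl⟩
    exact map_mem_halfTree g (hcS ⟨s, hs, rfl⟩)

/-- Were `f` equivariant under `N`, so would be some different `G`-translate `f'`, and the two would
disagree everywhere. Following them fixes every neighbour of a fixed vertex, so the generators of
`N` would be trivial. -/
theorem not_equivariant_orientation (hT : T.IsTree) (hG : ¬ StabilisesProperSubtree G)
    (hend : ¬ FixesEnd G) (hconj : ∀ g ∈ G, ∀ n ∈ N, g * n * g⁻¹ ∈ N)
    (hfix : ∀ x, ∃ n ∈ N, n x ≠ x)
    (hgen : N ≤ Subgroup.closure {n | n ∈ N ∧ ∃ x, n x = x})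
    {f : V → V} (hf : IsOrientation T f) : ∃ n ∈ N, ∃ x, n (f x) ≠ f (n x) := by
  by_contra! hN
  have hg : ∃ g ∈ G, ∃ x, g (f x) ≠ f (g x) := by
    by_contra! h
    exact hend (hf.fixesEnd hT h)
  obtain ⟨g, hg, x0, hx0⟩ := hg
  have hf' := hf.conj g
  set f' : V → V := fun x => g (f (g⁻¹ x)) with hf'_def
  have hN' : ∀ n ∈ N, ∀ x, n (f' x) = f' (n x) := by
    intro n hn x
    have := hN _ (hconj g⁻¹ (G.inv_mem hg) n hn) (g⁻¹ x)
    apply (g⁻¹).injective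
    simpa [hf'_def] using this
  have hS : {x | ∃ i j : Bool, (if i then f else f') x ≠ (if j then f else f') x} = Set.univ := by
    refine convex_eq_univ hT hG hend hconj hfix
      (IsOrientation.isConvex_disagree hT (f := fun i : Bool => if i then f else f') ?_)
      ⟨g x0, false, true, ?_⟩ ?_
    · rintro (_ | _)
      · simpa using hf'
      · simpa using hf
    · simpa [hf'_def] using hx0
    · rintro n hn x ⟨i, j, hij⟩
      refine ⟨i, j, fun h => hij ?_⟩
      apply n.injective
      cases i <;> cases j <;> simp_all
  have hne : ∀ x, f x ≠ f' x := by
    intro x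
    obtain ⟨i, j, hij⟩ : x ∈ {x | ∃ i j : Bool,
      (if i then f else f') x ≠ (if j then f else f') x} := hS ▸ Set.mem_univ x
    cases i <;> cases j <;> simp_all [Ne.symm]
  have hone : ∀ n ∈ N, ∀ x, n x = x → n = 1 := by
    intro n hn x hx
    ext y
    refine adj_induction hT (P := fun y => n y = y) hx ?_ y
    intro p q hpq hp
    -- An edge directed from `q` to `p` by both orientations would be an agreement at `q`.
    have hcase : f p = q ∨ f' p = q := by
      by_cases h : f p = q
      · exact Or.inl h
      · have h1 := (hf.or p q hpq).resolve_left h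
        refine Or.inr ((hf'.or p q hpq).resolve_right fun h2 => hne q ?_)
        rw [h1, h2]
    rcases hcase with rfl | rfl
    · rw [hN n hn, hp]
    · rw [hN' n hn, hp]
  have hbot : N ≤ ⊥ := hgen.trans <| (Subgroup.closure_le _).2 fun n ⟨hn, x, hx⟩ => by
    simpa using hone n hn x hx
  obtain ⟨n, hn, h⟩ := hfix x0
  apply h
  rw [Subgroup.mem_bot.1 (hbot hn)]
  rfl

end Normal

/-! ### The group generated by the edge fixators -/

section Plus

variable {G : Subgroup (T ≃g T)} {k : ℕ}

theorem plusGroup_le : plusGroup G k ≤ G :=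
  (Subgroup.closure_le _).2 fun _ ⟨_, _, _, h⟩ => h.1

theorem edgeFixator_le_plusGroup {v w : V} (h : T.Adj v w) :
    edgeFixator G k v w ≤ plusGroup G k := fun _ hg => Subgroup.subset_closure ⟨v, w, h, hg⟩

theorem dist_map (g : T ≃g T) (x y : V) : T.dist (g x) (g y) = T.dist x y := by
  have key : ∀ (g : T ≃g T) (x y : V), T.Reachable x y → T.dist (g x) (g y) ≤ T.dist x y := by
    intro g x y h
    obtain ⟨p, hp⟩ := h.exists_walk_length_eq_dist
    rw [← hp, ← SimpleGraph.Walk.length_map g.toHom p]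
    exact SimpleGraph.dist_le _
  by_cases h : T.Reachable x y
  · refine le_antisymm (key g x y h) ?_
    have := key g⁻¹ (g x) (g y) (h.map g.toHom)
    simpa using this
  · have h' : ¬ T.Reachable (g x) (g y) := fun h' => h (by simpa using h'.map (g⁻¹).toHom)
    rw [SimpleGraph.dist_eq_zero_of_not_reachable h, SimpleGraph.dist_eq_zero_of_not_reachable h']

theorem conj_mem_plusGroup {g n : T ≃g T} (hg : g ∈ G) (hn : n ∈ plusGroup G k) :
    g * n * g⁻¹ ∈ plusGroup G k := by
  induction hn using Subgroup.closure_induction with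
  | mem n hn =>
    obtain ⟨v, w, hvw, hn⟩ := hn
    refine Subgroup.subset_closure ⟨g v, g w, g.map_rel_iff.2 hvw,
      G.mul_mem (G.mul_mem hg hn.1) (G.inv_mem hg), ?_⟩
    rintro y ⟨hy1, hy2⟩
    have h1 : n (g⁻¹ y) = g⁻¹ y := by
      refine hn.2 _ ⟨?_, ?_⟩
      · have := dist_map g v (g⁻¹ y)
        rw [RelIso.apply_inv_self] at this
        exact this.symm.trans_le hy1
      · have := dist_map g w (g⁻¹ y)
        rw [RelIso.apply_inv_self] at this
        exact this.symm.trans_le hy2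
    simp [h1]
  | one => simp
  | mul a b _ _ ha hb =>
    have := (plusGroup G k).mul_mem ha hb
    simpa [mul_assoc] using this
  | inv a _ ha =>
    have := (plusGroup G k).inv_mem ha
    simpa [mul_assoc] using this

variable (G k) in
/-- The elements of the edge fixators that fix a half-tree pointwise. -/
def halfTreeFixators : Set (T ≃g T) :=
  {u | ∃ v w, T.Adj v w ∧ u ∈ fixator (edgeFixator G k v w) (halfTree T v w)}

theorem halfTreeFixators_subset : halfTreeFixators G k ⊆ plusGroup G k :=
  fun _ ⟨_, _, h, hu⟩ => edgeFixator_le_plusGroup h hu.1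

theorem edgeFixator_comm (v w : V) : edgeFixator G k v w = edgeFixator G k w v := by
  rw [edgeFixator, edgeFixator, Set.inter_comm]

theorem plusGroup_le_closure (hP : PropertyP G k) :
    plusGroup G k ≤ Subgroup.closure (halfTreeFixators G k) := by
  refine (Subgroup.closure_le _).2 ?_
  rintro n ⟨v, w, hvw, hn⟩
  have h : n ∈ (edgeFixator G k v w : Set (T ≃g T)) := hn
  rw [hP v w hvw] at h
  obtain ⟨a, ha, b, hb, rfl⟩ := h
  refine Subgroup.mul_mem _ (Subgroup.subset_closure ⟨v, w, hvw, ha⟩)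
    (Subgroup.subset_closure ⟨w, v, hvw.symm, ?_⟩)
  rw [edgeFixator_comm]
  exact hb

/-- Otherwise every translate of `f` under `plusGroup G k` points from `b` to `a`. But the
translates disagree somewhere, and their disagreement set is convex and invariant, hence contains
`b`. -/
theorem exists_map_orientation (hT : T.IsTree) (hG : ¬ StabilisesProperSubtree G)
    (hend : ¬ FixesEnd G) (hP : PropertyP G k) (hfix : ∀ x, ∃ n ∈ plusGroup G k, n x ≠ x)
    {f : V → V} (hf : IsOrientation T f) {a b : V} (hab : T.Adj a b) :
    ∃ c ∈ plusGroup G k, f (c a) = c b := by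
  have hconj : ∀ g ∈ G, ∀ n ∈ plusGroup G k, g * n * g⁻¹ ∈ plusGroup G k :=
    fun g hg n hn => conj_mem_plusGroup hg hn
  have hfixers : halfTreeFixators G k ⊆ {n | n ∈ plusGroup G k ∧ ∃ x, n x = x} := by
    intro u hu
    obtain ⟨v, w, h, hu'⟩ := hu
    exact ⟨halfTreeFixators_subset ⟨v, w, h, hu'⟩, w, hu'.2 w (self_mem_halfTree _ _)⟩
  obtain ⟨n, hn, x, hx⟩ := not_equivariant_orientation hT hG hend hconj hfix
    ((plusGroup_le_closure hP).trans (Subgroup.closure_mono hfixers)) hf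
  have huniv := convex_eq_univ hT hG hend hconj hfix
    (IsOrientation.isConvex_disagree hT
      (f := fun (c : plusGroup G k) x => (c : T ≃g T) (f ((c : T ≃g T)⁻¹ x)))
      fun c => hf.conj _) ⟨n x, ⟨n, hn⟩, 1, by simpa using hx⟩ (by
        rintro m hm y ⟨c, d, hcd⟩
        refine ⟨⟨m, hm⟩ * c, ⟨m, hm⟩ * d, ?_⟩
        simpa using hcd)
  by_contra! hc
  obtain ⟨c, d, hcd⟩ : b ∈ _ := huniv.symm ▸ Set.mem_univ b
  have key : ∀ c : plusGroup G k, (c : T ≃g T) (f ((c : T ≃g T)⁻¹ b)) = a := by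
    intro c
    have h1 := hc _ (c⁻¹).2
    have h2 := (hf.or _ _
      (((c⁻¹ : plusGroup G k) : T ≃g T).map_rel_iff.2 hab)).resolve_left h1
    apply ((c : T ≃g T)⁻¹).injective
    simpa using h2
  exact hcd ((key c).trans (key d).symm)

end Plus

/-! ### Ultrafilters of automorphisms -/

section Ultrafilter

open Filter

variable {M : Type*} {𝒰 : Ultrafilter M} {m : M → (T ≃g T)}

theorem eventually_apply_eq_of_exists [T.LocallyFinite] (hT : T.IsTree) {x w : V}
    (h : ∀ᶠ i in 𝒰, m i x = w) (y : V) : ∃ z, ∀ᶠ i in 𝒰, m i y = z := by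
  refine adj_induction hT (P := fun y => ∃ z, ∀ᶠ i in 𝒰, m i y = z) ⟨w, h⟩ ?_ y
  rintro p q hpq ⟨z, hz⟩
  -- The image of `q` is one of finitely many neighbours of `z`, and the ultrafilter selects one.
  have h1 : (⋃ t ∈ T.neighborSet z, {i | m i q = t}) ∈ 𝒰 := by
    filter_upwards [hz] with i hi
    simp only [Set.mem_iUnion]
    exact ⟨m i q, hi ▸ (m i).map_rel_iff.2 hpq, rfl⟩
  obtain ⟨t, -, ht⟩ := (Ultrafilter.finite_biUnion_mem_iff (Set.toFinite _)).1 h1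
  exact ⟨t, ht⟩

theorem exists_tendsto_of_eventually_apply_eq [T.LocallyFinite] (hT : T.IsTree) {x w : V}
    (h : ∀ᶠ i in 𝒰, m i x = w) : ∃ σ : T ≃g T, Tendsto m 𝒰 (nhds σ) := by
  choose σ hσ using eventually_apply_eq_of_exists hT h
  have h' : ∀ᶠ i in 𝒰, (m i)⁻¹ w = x := by
    filter_upwards [h] with i hi
    simp [← hi]
  -- The inverses also converge pointwise, and their limit inverts `σ`.
  choose τ hτ using eventually_apply_eq_of_exists (m := fun i => (m i)⁻¹) hT h'
  refine ⟨⟨⟨σ, τ, fun y => ?_, fun y => ?_⟩, fun {a b} => ?_⟩, fun U hU => ?_⟩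
  · obtain ⟨i, h1, h2⟩ := ((hσ y).and (hτ (σ y))).exists
    rw [← h2, ← h1]
    simp
  · obtain ⟨i, h1, h2⟩ := ((hτ y).and (hσ (τ y))).exists
    rw [← h2, ← h1]
    simp
  · obtain ⟨i, h1, h2⟩ := ((hσ a).and (hσ b)).exists
    change T.Adj (σ a) (σ b) ↔ T.Adj a b
    rw [← h1, ← h2]
    exact (m i).map_rel_iff
  · obtain ⟨F, hF⟩ := mem_nhds_iff_basicSet.1 hU
    have h1 : ∀ᶠ i in 𝒰, ∀ y ∈ F, m i y = σ y :=
      (Filter.eventually_all_finset F).2 fun y _ => hσ y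
    exact mem_of_superset h1 fun i hi => hF hi

theorem exists_orientation_of_escape [T.LocallyFinite] (hT : T.IsTree)
    (h : ∀ x w, ¬ ∀ᶠ i in 𝒰, m i x = w) (v : V) :
    ∃ f, IsOrientation T f ∧ ∀ x, ∀ᶠ i in 𝒰, m i v ∈ halfTree T x (f x) := by
  have hex : ∀ x, ∃ y, T.Adj x y ∧ ∀ᶠ i in 𝒰, m i v ∈ halfTree T x y := by
    intro x
    have h1 : (⋃ t ∈ T.neighborSet x, {i | m i v ∈ halfTree T x t}) ∈ 𝒰 := by
      filter_upwards [Ultrafilter.eventually_not.2 (h v x)] with i hi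
      simp only [Set.mem_iUnion]
      obtain ⟨y, hy, hm⟩ := exists_mem_halfTree hT hi
      exact ⟨y, hy, hm⟩
    obtain ⟨t, ht, htm⟩ := (Ultrafilter.finite_biUnion_mem_iff (Set.toFinite _)).1 h1
    exact ⟨t, ht, htm⟩
  choose f hadj hf using hex
  refine ⟨f, ⟨hadj, fun x hx => ?_, fun x y hxy => ?_⟩, hf⟩
  · obtain ⟨i, h1, h2⟩ := ((hf x).and (hf (f x))).exists
    rw [hx] at h2
    exact notMem_halfTree_opposite hT (hadj x) h1 h2
  · obtain ⟨i, h1, h2⟩ := ((hf x).and (hf y)).exists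
    rcases mem_halfTree_or hT hxy (m i v) with h3 | h3
    · exact Or.inl (halfTree_unique hT (hadj x) hxy h1 h3)
    · exact Or.inr (halfTree_unique hT (hadj y) hxy.symm h2 h3)

/-- Passing to a neighbour `q` can leave the half-tree only when `q` is sent to `a`, which escape
rules out eventually. -/
theorem eventually_mem_halfTree (hT : T.IsTree) (h : ∀ x w, ¬ ∀ᶠ i in 𝒰, m i x = w) {a b v : V}
    (hab : T.Adj a b) (hv : ∀ᶠ i in 𝒰, m i v ∈ halfTree T a b) (x : V) :
    ∀ᶠ i in 𝒰, m i x ∈ halfTree T a b := by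
  refine adj_induction hT (P := fun x => ∀ᶠ i in 𝒰, m i x ∈ halfTree T a b) hv ?_ x
  intro p q hpq hp
  filter_upwards [hp, Ultrafilter.eventually_not.2 (h q a)] with i h1 h2
  by_contra h3
  exact h2 (halfTree_crossing hT hab ((m i).map_rel_iff.2 hpq) h1 h3).2

/-- An escaping ultrafilter contracts the elements that fix a half-tree around its limit end. -/
theorem tendsto_conj_of_fixes_halfTree (hT : T.IsTree) (h : ∀ x w, ¬ ∀ᶠ i in 𝒰, m i x = w)
    {a b v : V} (hab : T.Adj a b) (hv : ∀ᶠ i in 𝒰, m i v ∈ halfTree T a b) {u : T ≃g T}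
    (hu : ∀ y ∈ halfTree T a b, u y = y) :
    Tendsto (fun i => (m i)⁻¹ * u * m i) 𝒰 (nhds 1) := by
  intro U hU
  obtain ⟨F, hF⟩ := mem_nhds_iff_basicSet.1 hU
  have h1 : ∀ᶠ i in 𝒰, ∀ y ∈ F, m i y ∈ halfTree T a b :=
    (Filter.eventually_all_finset F).2 fun y _ => eventually_mem_halfTree hT h hab hv y
  refine mem_map.2 (mem_of_superset h1 fun i hi => hF fun y hy => ?_)
  simp [hu _ (hi y hy)]

end Ultrafilter

/-! ### Closedness of the generated group, and ultrafilters on it -/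

theorem finite_ball [T.LocallyFinite] (hT : T.IsTree) (v : V) (n : ℕ) : (ball T v n).Finite := by
  induction n with
  | zero =>
    refine (Set.finite_singleton v).subset fun u hu => ?_
    exact (hT.1.dist_eq_zero_iff.1 (Nat.le_zero.1 hu)).symm
  | succ n ih =>
    refine (ih.union (ih.biUnion fun u _ => (T.neighborSet u).toFinite)).subset fun u hu => ?_
    obtain ⟨p, hp⟩ := hT.1.exists_walk_length_eq_dist u v
    cases p with
    | nil => exact Or.inl (by simp [ball])
    | @cons _ q _ h r =>
      have h1 : T.dist v u ≤ n + 1 := hu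
      rw [SimpleGraph.dist_comm, ← hp, SimpleGraph.Walk.length_cons] at h1
      refine Or.inr (Set.mem_biUnion (x := q) ?_ h.symm)
      change T.dist v q ≤ n
      rw [SimpleGraph.dist_comm]
      exact (SimpleGraph.dist_le r).trans (by omega)

/-- An edge fixator is open in `G`, being the fixator of a finite set, and an open subgroup is
closed. -/
theorem isClosed_plusGroup [Infinite V] [T.LocallyFinite] (hT : T.IsTree)
    {G : Subgroup (T ≃g T)} (hG : IsClosed (G : Set (T ≃g T))) (k : ℕ) :
    IsClosed (plusGroup G k : Set (T ≃g T)) := by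
  rw [← closure_subset_iff_isClosed]
  intro σ hσ
  have hσG : σ ∈ G := hG.closure_subset_iff.2 plusGroup_le hσ
  obtain ⟨v, w', hne⟩ := exists_pair_ne V
  obtain ⟨w, hvw, -⟩ := exists_mem_halfTree hT hne.symm
  have hfin : (ball T v k ∩ ball T w k).Finite := (finite_ball hT v k).inter_of_left _
  obtain ⟨g, hg, hgN⟩ := mem_closure_iff_nhds.1 hσ (basicSet σ hfin.toFinset)
    (mem_nhds_iff_basicSet.2 ⟨_, subset_rfl⟩)
  have h1 : g⁻¹ * σ ∈ plusGroup G k := by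
    refine edgeFixator_le_plusGroup hvw ⟨G.mul_mem (G.inv_mem (plusGroup_le hgN)) hσG, ?_⟩
    intro y hy
    have := hg y (hfin.mem_toFinset.2 hy)
    simp [← this]
  simpa using (plusGroup G k).mul_mem hgN h1

theorem exists_nhds_of_eventually_apply_eq [Infinite V] [T.LocallyFinite] (hT : T.IsTree)
    {G : Subgroup (T ≃g T)} (hG : IsClosed (G : Set (T ≃g T))) {k : ℕ}
    {𝒰 : Ultrafilter (plusGroup G k)} {x w : V} (h : ∀ᶠ g : plusGroup G k in 𝒰, (g : T ≃g T) x = w) :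
    ∃ σ, (𝒰 : Filter (plusGroup G k)) ≤ nhds σ := by
  obtain ⟨σ, hσ⟩ := exists_tendsto_of_eventually_apply_eq hT h
  have hσN : σ ∈ plusGroup G k :=
    (isClosed_plusGroup hT hG k).mem_of_tendsto hσ (Filter.Eventually.of_forall fun g => g.2)
  refine ⟨⟨σ, hσN⟩, ?_⟩
  rw [nhds_subtype_eq_comap, ← Filter.map_le_iff_le_comap]
  exact hσ

/-- A homomorphism that converges along an escaping ultrafilter is trivial. -/
theorem map_eq_one_of_escape [T.LocallyFinite] (hT : T.IsTree)
    {G : Subgroup (T ≃g T)} (hsubtree : ¬ StabilisesProperSubtree G) (hend : ¬ FixesEnd G)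
    {k : ℕ} (hP : PropertyP G k) (hfix : ∀ x, ∃ n ∈ plusGroup G k, n x ≠ x)
    {H : Type v} [Group H] [TopologicalSpace H] [IsTopologicalGroup H] [T2Space H]
    {φ : plusGroup G k →* H} (hφ : Continuous φ) {𝒰 : Ultrafilter (plusGroup G k)} {h : H}
    (hlim : Filter.Tendsto φ 𝒰 (nhds h))
    (hesc : ∀ x w, ¬ ∀ᶠ g : plusGroup G k in 𝒰, (g : T ≃g T) x = w) (g : plusGroup G k) : φ g = 1 := by
  have : Nonempty V := hT.1.nonempty
  obtain ⟨f, hf, hfU⟩ := exists_orientation_of_escape hT hesc (Classical.arbitrary V)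
  have key : ∀ (a b : V) (u : plusGroup G k), T.Adj a b → f a = b →
      (∀ y ∈ halfTree T a b, (u : T ≃g T) y = y) → φ u = 1 := by
    intro a b u hab hfa hu
    have h1 : Filter.Tendsto (fun g : plusGroup G k => g⁻¹ * u * g) 𝒰 (nhds 1) := by
      rw [nhds_subtype_eq_comap, Filter.tendsto_comap_iff]
      exact tendsto_conj_of_fixes_halfTree hT hesc hab (hfa ▸ hfU a) hu
    have h2 : Filter.Tendsto (fun g : plusGroup G k => φ (g⁻¹ * u * g)) 𝒰 (nhds 1) := by
      have := (hφ.tendsto 1).comp h1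
      rwa [map_one] at this
    have h3 : Filter.Tendsto (fun g : plusGroup G k => φ (g⁻¹ * u * g)) 𝒰
        (nhds (h⁻¹ * φ u * h)) := by
      simp only [map_mul, map_inv]
      exact (hlim.inv.mul tendsto_const_nhds).mul hlim
    have h4 : h⁻¹ * φ u * h = 1 := tendsto_nhds_unique h3 h2
    have h5 : φ u = h * (h⁻¹ * φ u * h) * h⁻¹ := by group
    rw [h5, h4]
    group
  have hle : plusGroup G k ≤ φ.ker.map (plusGroup G k).subtype := by
    refine (plusGroup_le_closure hP).trans ((Subgroup.closure_le _).2 ?_)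
    rintro u hu
    have huN := halfTreeFixators_subset hu
    obtain ⟨a, b, hab, hu⟩ := hu
    refine ⟨⟨u, huN⟩, ?_, rfl⟩
    -- Conjugation by `c` turns the fixed half-tree towards the limit end, where `key` applies.
    obtain ⟨c, hc, hfc⟩ := exists_map_orientation hT hsubtree hend hP hfix hf hab
    have h1 : φ (⟨c, hc⟩ * ⟨u, huN⟩ * ⟨c, hc⟩⁻¹) = 1 := by
      refine key (c a) (c b) _ (c.map_rel_iff.2 hab) hfc fun y hy => ?_
      have h2 : u (c⁻¹ y) = c⁻¹ y := by
        refine hu.2 _ ?_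
        rw [← map_mem_halfTree_iff c]
        simpa using hy
      simp [h2]
    rw [map_mul, map_mul, map_inv] at h1
    exact conj_eq_one_iff.1 h1
  obtain ⟨g', hg', h1⟩ := hle g.2
  obtain rfl : g' = g := Subtype.ext h1
  exact hg'

end TreeAut

theorem mainTheorem2 {V : Type u} [Infinite V] (T : SimpleGraph V) [T.LocallyFinite]
    (hT : T.IsTree) (hleaf : ∀ x : V, T.degree x ≠ 1)
    (G : Subgroup (T ≃g T)) (hclosed : IsClosed (G : Set (T ≃g T)))
    (hsubtree : ¬ TreeAut.StabilisesProperSubtree G) (hend : ¬ TreeAut.FixesEnd G)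
    (k : ℕ) (hP : TreeAut.PropertyP G k) :
    TreeAut.ClosedRangeProperty.{u, v} (TreeAut.plusGroup G k) := by
  intro H _ _ _ _ φ hφ
  have htriv : (∀ g, φ g = 1) → IsClosed (Set.range φ) := by
    intro h
    have : Set.range φ = {1} :=
      Set.Subset.antisymm (Set.range_subset_iff.2 h) 
        (Set.singleton_subset_iff.2 ⟨1, map_one φ⟩)
    rw [this]
    exact isClosed_singleton
  by_cases hfix : ∀ x, ∃ n ∈ TreeAut.plusGroup G k, n x ≠ x
  · by_cases h1 : ∀ g, φ g = 1
    · exact htriv h1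
    · rw [← closure_subset_iff_isClosed]
      intro h hh
      -- Since `h` is a limit point of the range, an ultrafilter on the domain can be chosen along
      -- which `φ` tends to `h`.
      have hne : (Filter.comap φ (nhds h)).NeBot := by
        rw [Filter.comap_neBot_iff]
        intro t ht
        obtain ⟨_, hy, g, rfl⟩ := mem_closure_iff_nhds.1 hh t ht
        exact ⟨g, hy⟩
      obtain ⟨𝒰, h𝒰⟩ := Ultrafilter.exists_le (Filter.comap φ (nhds h))
      have hlim : Filter.Tendsto φ 𝒰 (nhds h) := Filter.tendsto_iff_comap.2 h𝒰
      by_cases hesc : ∀ x w, ¬ ∀ᶠ g : TreeAut.plusGroup G k in 𝒰, (g : T ≃g T) x = w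
      · exact absurd
          (TreeAut.map_eq_one_of_escape hT hsubtree hend hP hfix hφ hlim hesc) h1
      · push Not at hesc
        obtain ⟨x, w, hxw⟩ := hesc
        obtain ⟨σ, hσ⟩ := TreeAut.exists_nhds_of_eventually_apply_eq hT hclosed hxw
        exact ⟨σ, tendsto_nhds_unique ((hφ.tendsto σ).mono_left hσ) hlim⟩
  · push Not at hfix
    obtain ⟨x, hx⟩ := hfix
    refine htriv fun g => ?_
    have h1 := TreeAut.eq_one_of_fixes_vertex hT hsubtree
      (fun g hg n hn => TreeAut.conj_mem_plusGroup hg hn) hx g g.2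
    rw [show g = 1 from Subtype.ext h1, map_one]
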